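/- For $n\ge 0$ write a permutation $\sigma$ of $[n]=\{1,\dots,n\}$ in one-line notation $\sigma_1\sigma_2\cdots\sigma_n$. Its descent set is $\mathrm{Des}(\sigma)=\{i\in[n-1] : \sigma_i>\sigma_{i+1}\}$; a peak (resp. valley) of $\sigma$ is a position $1<i<n$ such that $\sigma_i$ is larger (resp. smaller) than both $\sigma_{i-1}$ and $\sigma_{i+1}$; and $\mathrm{Spike}(\sigma)$ is the set of all peaks and valleys of $\sigma$. For a finite set $S$ of positive integers let $D(S,n)$ be the set of permutations of $[n]$ with descent set $S$. For a finite set $I$ of positive integers and $n>\max(I)$ (with $\max(\varnothing)=0$) let $P(I,n)$ be the set of permutations of $[n]$ with peak set $I$, and put $p(I,n)=2^{-n+|I|+1}\,|P(I,n)|$. Call a finite set $I$ of positive integers admissible if $1\notin I$ and $I$ contains no two consecutive integers. For admissible $I$ let $S_I$ be the descent set whose spikes are exactly the elements of $I$, alternating between peaks and valleys with the rightmost one a valley; that is, $j\ge 1$ lies in $S_I$ if and only if the number of $i\in I$ with $i>j$ is odd. For $0\le i\le n$ and a permutation $\sigma$ of $[n]$ with $\{\sigma_1,\dots,\sigma_i\}=\{a_1<\cdots<a_i\}$,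 let $\mathrm{fl}_i(\sigma)$ be the permutation with $\mathrm{fl}_i(\sigma)_j=a_{i-r+1}$ if $j\le i$ and $\sigma_j=a_r$, and $\mathrm{fl}_i(\sigma)_j=\sigma_j$ if $j>i$. We say that $\sigma$ admits an $i$-flip if $i\in\mathrm{Spike}(\sigma)$ and at least one of $\mathrm{Spike}(\mathrm{fl}_i(\sigma))$, $\mathrm{Spike}(\mathrm{fl}_{i-1}(\sigma))$ equals $\mathrm{Spike}(\sigma)\setminus\{i\}$. **Theorem.** Let $I$ be an admissible set and let $m\ge\max(I)$ be an integer. For $0\le k\le m$ let $b_k(I)$ be the number of $\sigma\in D(S_I,2m)$ such that $$\{\sigma_1,\dots,\sigma_m\}\cap[m+1,2m]=[m+1,m+k]$$ and $\sigma$ admits no $i$-flip for any $i$. Then for every integer $n>\max(I)$ $$p(I,n)=\sum_{k=0}^{m} b_k(I)\binom{n-m}{k},$$ where $\binom{x}{k}=x(x-1)\cdots(x-k+1)/k!$. Moreover, the $b_k(I)$ are the only rational coefficients for which this expansion holds for all $n>\max(I)$; in particular, the coefficients of the peak polynomial of $I$ in the binomial basis centered at $m$ are nonnegative. -/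

import Mathlib

/-!
Permutations `σ ∈ 𝔖_n` are elements of `Equiv.Perm (Fin n)`; positions and values are read
1-based, in one-line notation `σ_1 σ_2 ⋯ σ_n`, through `PeakPoly.val`.
-/

namespace PeakPoly

/-- The entry `σ_i ∈ {1, …, n}` of the one-line notation of `σ`, for a position `1 ≤ i ≤ n`
(and `0` for every other `i`; such positions are never used below). -/
def val {n : ℕ} (σ : Equiv.Perm (Fin n)) (i : ℕ) : ℕ :=
  if h : 1 ≤ i ∧ i ≤ n then (σ ⟨i - 1, by omega⟩ : ℕ) + 1 else 0

/-- `Des(σ) = {i ∈ [n-1] : σ_i > σ_{i+1}}`. -/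
def des {n : ℕ} (σ : Equiv.Perm (Fin n)) : Finset ℕ :=
  (Finset.Icc 1 (n - 1)).filter fun i => val σ (i + 1) < val σ i

/-- `Peak(σ)`: the positions `1 < i < n` with `σ_{i-1} < σ_i > σ_{i+1}`. -/
def peak {n : ℕ} (σ : Equiv.Perm (Fin n)) : Finset ℕ :=
  (Finset.Icc 2 (n - 1)).filter fun i => val σ (i - 1) < val σ i ∧ val σ (i + 1) < val σ i

/-- `Valley(σ)`: the positions `1 < i < n` with `σ_{i-1} > σ_i < σ_{i+1}`. -/
def valley {n : ℕ} (σ : Equiv.Perm (Fin n)) : Finset ℕ :=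
  (Finset.Icc 2 (n - 1)).filter fun i => val σ i < val σ (i - 1) ∧ val σ i < val σ (i + 1)

/-- `Spike(σ) = Peak(σ) ∪ Valley(σ)`. -/
def spike {n : ℕ} (σ : Equiv.Perm (Fin n)) : Finset ℕ := peak σ ∪ valley σ

/-- `D(S,n)`: the permutations in `𝔖_n` with descent set `S`. -/
def descentClass (S : Finset ℕ) (n : ℕ) : Finset (Equiv.Perm (Fin n)) :=
  Finset.univ.filter fun σ => des σ = S

/-- `P(I,n)`: the permutations in `𝔖_n` with peak set `I`. -/
def peakClass (I : Finset ℕ) (n : ℕ) : Finset (Equiv.Perm (Fin n)) :=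
  Finset.univ.filter fun σ => peak σ = I

/-- `p(I,n) = 2^{-n+|I|+1} |P(I,n)|`. -/
def peakNumber (I : Finset ℕ) (n : ℕ) : ℚ :=
  (2 : ℚ) ^ (-(n : ℤ) + (I.card : ℤ) + 1) * ((peakClass I n).card : ℚ)

/-- Admissible sets: `1 ∉ I` and no two consecutive elements (elements are positive). -/
def IsAdmissible (I : Finset ℕ) : Prop :=
  ∀ i ∈ I, 2 ≤ i ∧ i + 1 ∉ I

/-- The spikes of a set `S ⊆ [n-1]`: its peaks (`i ∈ S`, `i - 1 ∉ S`) and its valleys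
(`i ∉ S`, `i - 1 ∈ S`), for `1 < i ≤ n - 1`. -/
def setSpike (n : ℕ) (S : Finset ℕ) : Finset ℕ :=
  (Finset.Icc 2 (n - 1)).filter fun i => (i ∈ S ∧ i - 1 ∉ S) ∨ (i ∉ S ∧ i - 1 ∈ S)

/-- `S_I`: the descent set whose spikes are the elements of `I`, alternating between peaks and
valleys, the rightmost one being a valley. Equivalently, a position `j ≥ 1` is a descent exactly
if an odd number of elements of `I` lie to the right of it. See `eq_spikeDescents_iff`. -/
def spikeDescents (I : Finset ℕ) : Finset ℕ :=
  (Finset.Icc 1 (I.sup id)).filter fun j => Odd ((I.filter fun i => j < i).card)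

theorem mem_spikeDescents (I : Finset ℕ) (j : ℕ) :
    j ∈ spikeDescents I ↔ 1 ≤ j ∧ Odd ((I.filter fun i => j < i).card) := by
  simp only [spikeDescents, Finset.mem_filter, Finset.mem_Icc]
  refine ⟨fun h => ⟨h.1.1, h.2⟩, fun h => ⟨⟨h.1, ?_⟩, h.2⟩⟩
  obtain ⟨i, hi⟩ := Finset.card_pos.1 h.2.pos
  rw [Finset.mem_filter] at hi
  exact hi.2.le.trans (Finset.le_sup (f := id) hi.1)

/-- `S_I` is the unique `S ⊆ [n-1]` with `Spike(S) = I` that ends in an ascent (which, for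
nonempty `I`, says that the rightmost spike is not a peak). -/
theorem eq_spikeDescents_iff {n : ℕ} (hn : 2 ≤ n) {I : Finset ℕ}
    (hI : I ⊆ Finset.Icc 2 (n - 1)) (S : Finset ℕ) :
    S = spikeDescents I ↔ S ⊆ Finset.Icc 1 (n - 1) ∧ setSpike n S = I ∧ n - 1 ∉ S := by
  have step : ∀ j, 1 ≤ j → (j ∈ spikeDescents I ↔
      ((j + 1 ∈ spikeDescents I ∧ j + 1 ∉ I) ∨ (j + 1 ∉ spikeDescents I ∧ j + 1 ∈ I))) := by
    intro j hj
    have hc : (I.filter fun i => j < i).card =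
        (I.filter fun i => j + 1 < i).card + if j + 1 ∈ I then 1 else 0 := by
      split_ifs with h
      · rw [show (I.filter fun i => j < i) = insert (j + 1) (I.filter fun i => j + 1 < i) by
          ext x; simp only [Finset.mem_filter, Finset.mem_insert]
          constructor
          · rintro ⟨h1, h2⟩
            rcases Nat.eq_or_lt_of_le (Nat.succ_le_of_lt h2) with h3 | h3
            · exact Or.inl h3.symm
            · exact Or.inr ⟨h1, h3⟩
          · rintro (rfl | ⟨h1, h2⟩)
            · exact ⟨h, by omega⟩
            · exact ⟨h1, by omega⟩]
        rw [Finset.card_insert_of_notMem (by simp)]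
      · rw [add_zero]
        congr 1
        ext x; simp only [Finset.mem_filter]
        refine ⟨fun ⟨h1, h2⟩ => ⟨h1, ?_⟩, fun ⟨h1, h2⟩ => ⟨h1, by omega⟩⟩
        rcases Nat.eq_or_lt_of_le (Nat.succ_le_of_lt h2) with h3 | h3
        · exact absurd (by rw [← h3] at h1; exact h1) h
        · exact h3
    simp only [mem_spikeDescents, hc]
    split_ifs with h <;> simp [h, hj, Nat.odd_add_one]
  have top : ∀ j, n - 1 ≤ j → j ∉ spikeDescents I := by
    intro j hj h
    rw [mem_spikeDescents] at h
    obtain ⟨i, hi⟩ := Finset.card_pos.1 h.2.pos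
    rw [Finset.mem_filter] at hi
    have := Finset.mem_Icc.1 (hI hi.1)
    omega
  constructor
  · rintro rfl
    refine ⟨fun j hj => ?_, ?_, top _ le_rfl⟩
    · have h1 := ((mem_spikeDescents I j).1 hj).1
      have h2 : ¬ n - 1 ≤ j := fun h => top j h hj
      exact Finset.mem_Icc.2 ⟨h1, by omega⟩
    · ext i
      simp only [setSpike, Finset.mem_filter]
      constructor
      · rintro ⟨h1, h2⟩
        obtain ⟨h3, h4⟩ := Finset.mem_Icc.1 h1
        have := step (i - 1) (by omega)
        rw [Nat.sub_add_cancel (by omega)] at this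
        tauto
      · intro h
        obtain ⟨h3, h4⟩ := Finset.mem_Icc.1 (hI h)
        have := step (i - 1) (by omega)
        rw [Nat.sub_add_cancel (by omega)] at this
        exact ⟨hI h, by tauto⟩
  · rintro ⟨hS, hsp, hlast⟩
    have key : ∀ d j, 1 ≤ j → j + d = n - 1 → (j ∈ S ↔ j ∈ spikeDescents I) := by
      intro d
      induction d with
      | zero =>
        intro j _ hj
        have : j = n - 1 := by omega
        subst this
        exact iff_of_false hlast (top _ le_rfl)
      | succ d ih =>
        intro j h1 hj
        have h2 := ih (j + 1) (by omega) (by omega)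
        have h3 := step j h1
        have h4 : j + 1 ∈ I ↔ ((j + 1 ∈ S ∧ j ∉ S) ∨ (j + 1 ∉ S ∧ j ∈ S)) := by
          rw [← hsp]
          simp only [setSpike, Finset.mem_filter, Finset.mem_Icc, Nat.add_sub_cancel]
          exact ⟨fun h => h.2, fun h => ⟨⟨by omega, by omega⟩, h⟩⟩
        tauto
    ext j
    by_cases hj : 1 ≤ j ∧ j ≤ n - 1
    · exact key (n - 1 - j) j hj.1 (by omega)
    · refine iff_of_false (fun h => hj (Finset.mem_Icc.1 (hS h))) (fun h => ?_)
      have h1 := ((mem_spikeDescents I j).1 h).1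
      exact top j (by omega) h

/-- `{σ_1, …, σ_i}`, as a set of values in `[n]`. -/
def init {n : ℕ} (i : ℕ) (σ : Equiv.Perm (Fin n)) : Finset ℕ :=
  (Finset.Icc 1 i).image (val σ)

/-- The permutation of a finite linear order that reverses the set
`A = {a_1 < ⋯ < a_r}`, that is `a_k ↦ a_{r-k+1}`, and fixes every element outside `A`. -/
def reverseOn {n : ℕ} (A : Finset (Fin n)) : Equiv.Perm (Fin n) :=
  Equiv.Perm.ofSubtype
    ((A.orderIsoOfFin rfl).symm.toEquiv.trans
      (Fin.revPerm.trans (A.orderIsoOfFin rfl).toEquiv) : Equiv.Perm {x // x ∈ A})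

/-- `fl_i(σ)`: if `{σ_1, …, σ_i} = {a_1 < ⋯ < a_i}`, the entry `σ_j = a_k` is replaced by
`a_{i-k+1}` for `j ≤ i`, and the entries at positions `j > i` stay. (The first `i` positions are
the `j : Fin n` with `j < i`, and an entry lies in the set of the first `i` entries exactly if its
position is one of these.) -/
def fl {n : ℕ} (i : ℕ) (σ : Equiv.Perm (Fin n)) : Equiv.Perm (Fin n) :=
  reverseOn ((Finset.univ.filter fun j : Fin n => (j : ℕ) < i).image σ) * σ

/-- `σ` admits an `i⁺`-flip. -/
def AdmitsFlipPlus {n : ℕ} (σ : Equiv.Perm (Fin n)) (i : ℕ) : Prop :=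
  i ∈ spike σ ∧ spike (fl i σ) = spike σ \ {i}

/-- `σ` admits an `i⁻`-flip. -/
def AdmitsFlipMinus {n : ℕ} (σ : Equiv.Perm (Fin n)) (i : ℕ) : Prop :=
  i ∈ spike σ ∧ spike (fl (i - 1) σ) = spike σ \ {i}

/-- `σ` admits an `i`-flip. -/
def AdmitsFlip {n : ℕ} (σ : Equiv.Perm (Fin n)) (i : ℕ) : Prop :=
  AdmitsFlipPlus σ i ∨ AdmitsFlipMinus σ i

open Classical in
/-- `b_k(I)`, relative to `m`: the number of `σ ∈ D(S_I, 2m)` such that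
`{σ_1, …, σ_m} ∩ [m+1, 2m] = [m+1, m+k]` and `σ` admits no `i`-flip. -/
noncomputable def peakCoeff (I : Finset ℕ) (m k : ℕ) : ℕ :=
  ((descentClass (spikeDescents I) (2 * m)).filter fun σ =>
    init m σ ∩ Finset.Icc (m + 1) (2 * m) = Finset.Icc (m + 1) (m + k) ∧
      ∀ i, ¬ AdmitsFlip σ i).card

end PeakPoly

/-!
Encode `σ` by the word whose `j`-th letter is the number of earlier entries smaller than `σ_j` minus
the number of earlier entries larger than `σ_j`. The code has the descent set of `σ`, and `fl_i`
negates its first `i` letters. Hence `σ ∈ D(S_I, n)` admits no flip exactly if the absolute values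
of its code have the peak set `I`.

Whether two adjacent letters form a descent is decided by the sign of the one with the larger
absolute value. So in a family of words that is closed under changes of the signs of the letters,
the words whose absolute values have the peak set `J` are equidistributed over the descent sets that
have spikes at all elements of `J`, and inclusion-exclusion expresses the number of words with
descent set `S_I` and absolute peak set `I` by the distribution of the descent set. Both the codes
and the signed permutations form such a family. Fixing the set of negated values shows that each
descent set occurs `2 ^ n` times as often among the signed permutations, whose absolute values are
ordinary permutations; thus `p(I, n)` counts the flip-free `σ` in `D(S_I, n)`.

In such a `σ` the entries after position `m` increase. It is therefore determined by the relative
order of its first `m` entries and by the set `A` of these entries, and whether it is flip-free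
depends on `A` only through its longest initial interval, hence only on `A ∩ [m]`. Summing over the
choices of `A ∩ [m + 1, n]` gives the expansion for `n > m`; both expansions, centered at `m` and at
`max(I)`, are polynomial in `n`, so the restriction `n > m` can be dropped.
-/

namespace PeakPoly

open Finset
open scoped symmDiff

section Words

variable {α : Type*} [LinearOrder α] {n : ℕ} {x y : ℕ → α} {i : ℕ}

/-- The descent set of the word `x_1 ⋯ x_n`. -/
def descents (n : ℕ) (x : ℕ → α) : Finset ℕ :=
  {i ∈ Icc 1 (n - 1) | x (i + 1) < x i}

/-- The peak set of the word `x_1 ⋯ x_n`. -/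
def peaks (n : ℕ) (x : ℕ → α) : Finset ℕ :=
  {i ∈ Icc 2 (n - 1) | x (i - 1) < x i ∧ x (i + 1) < x i}

theorem mem_descents : i ∈ descents n x ↔ (1 ≤ i ∧ i < n) ∧ x (i + 1) < x i := by
  simp only [descents, mem_filter, mem_Icc]
  exact and_congr_left' (by omega)

theorem mem_peaks : i ∈ peaks n x ↔ (2 ≤ i ∧ i < n) ∧ x (i - 1) < x i ∧ x (i + 1) < x i := by
  simp only [peaks, mem_filter, mem_Icc]
  exact and_congr_left' (by omega)

theorem descents_subset (n : ℕ) (x : ℕ → α) : descents n x ⊆ Icc 1 (n - 1) :=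
  filter_subset _ _

theorem descents_congr (h : ∀ j ≤ n, x j = y j) : descents n x = descents n y := by
  ext i
  rw [mem_descents, mem_descents]
  refine and_congr_right fun hi => ?_
  rw [h i hi.2.le, h (i + 1) hi.2]

theorem peaks_congr (h : ∀ j ≤ n, x j = y j) : peaks n x = peaks n y := by
  ext i
  rw [mem_peaks, mem_peaks]
  refine and_congr_right fun hi => ?_
  rw [h i hi.2.le, h (i + 1) hi.2, h (i - 1) (by omega)]

theorem descents_succ_of_lt {m : ℕ} (hmn : m < n) :
    descents (m + 1) x = {i ∈ descents n x | i ≤ m} := by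
  ext i
  simp only [mem_filter, mem_descents]
  have hi : i < m + 1 ↔ i < n ∧ i ≤ m := by omega
  tauto

theorem peaks_succ_of_lt {m : ℕ} (hmn : m < n) : peaks (m + 1) x = {i ∈ peaks n x | i ≤ m} := by
  ext i
  simp only [mem_filter, mem_peaks]
  have hi : i < m + 1 ↔ i < n ∧ i ≤ m := by omega
  tauto

theorem mem_setSpike {S : Finset ℕ} :
    i ∈ setSpike n S ↔ (2 ≤ i ∧ i < n) ∧ ¬(i ∈ S ↔ i - 1 ∈ S) := by
  simp only [setSpike, mem_filter, mem_Icc]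
  exact and_congr (by omega) (by tauto)

theorem mem_setSpike_symmDiff_Ico {S : Finset ℕ} {r : ℕ} (hi : 2 ≤ i ∧ i < n) :
    i ∈ setSpike n (S ∆ Ico 1 r) ↔ ¬(i ∈ setSpike n S ↔ i = r) := by
  have hlt : i - 1 < r ↔ i < r ∨ i = r := by omega
  have hne : i = r → ¬i < r := by omega
  have h1 : 1 ≤ i ∧ 1 ≤ i - 1 := by omega
  simp only [mem_setSpike, mem_symmDiff, mem_Ico, h1, hlt, true_and]
  tauto

theorem spikeDescents_subset_and_setSpike_eq {I : Finset ℕ} (hI : I ⊆ Icc 2 (n - 1)) :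
    spikeDescents I ⊆ Icc 1 (n - 1) ∧ setSpike n (spikeDescents I) = I := by
  rcases le_or_gt 2 n with hn | hn
  · obtain ⟨hsub, hspike, -⟩ := (eq_spikeDescents_iff hn hI _).1 rfl
    exact ⟨hsub, hspike⟩
  · have hempty : Icc 2 (n - 1) = ∅ := Icc_eq_empty (by omega)
    obtain rfl : I = ∅ := subset_empty.1 (hempty ▸ hI)
    simp [spikeDescents, setSpike]

/-- Adding an element to `J` halves the count: toggling the descents to the left of `j` toggles the
spike at `j` and no other. -/
theorem two_pow_mul_card_subset_setSpike {J : Finset ℕ} (hJ : J ⊆ Icc 2 (n - 1)) :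
    2 ^ #J * #{S ∈ (Icc 1 (n - 1)).powerset | J ⊆ setSpike n S} = 2 ^ (n - 1) := by
  induction J using Finset.induction_on with
  | empty => simp
  | insert j J hj ih =>
    obtain ⟨hjn, hJn⟩ := insert_subset_iff.1 hJ
    have hjn' : 2 ≤ j ∧ j < n := by rw [mem_Icc] at hjn; omega
    have hIco : Ico 1 j ⊆ Icc 1 (n - 1) := fun e he => by
      rw [mem_Ico] at he; rw [mem_Icc]; omega
    have hmaps : ∀ S ∈ (Icc 1 (n - 1)).powerset, S ∆ Ico 1 j ∈ (Icc 1 (n - 1)).powerset :=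
      fun S hS => mem_powerset.2 <| symmDiff_le_sup.trans <| union_subset (mem_powerset.1 hS) hIco
    have hspikes : ∀ S : Finset ℕ, J ⊆ setSpike n (S ∆ Ico 1 j) ↔ J ⊆ setSpike n S := fun S =>
      forall₂_congr fun i hi => by
        have hin : 2 ≤ i ∧ i < n := by have := mem_Icc.1 (hJn hi); omega
        have hij : i ≠ j := fun h => hj (h ▸ hi)
        rw [mem_setSpike_symmDiff_Ico hin, iff_false_right hij, not_not]
    have hspike : ∀ S : Finset ℕ, j ∈ setSpike n (S ∆ Ico 1 j) ↔ j ∉ setSpike n S := fun S => by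
      rw [mem_setSpike_symmDiff_Ico hjn', iff_true_right rfl]
    have htoggle :
        #{S ∈ (Icc 1 (n - 1)).powerset | J ⊆ setSpike n S ∧ j ∈ setSpike n S} =
          #{S ∈ (Icc 1 (n - 1)).powerset | J ⊆ setSpike n S ∧ j ∉ setSpike n S} := by
      refine card_nbij' (· ∆ Ico 1 j) (· ∆ Ico 1 j) (fun S hS => ?_) (fun S hS => ?_)
        (fun S _ => symmDiff_symmDiff_cancel_right _ _)
        (fun S _ => symmDiff_symmDiff_cancel_right _ _) <;>
      · rw [mem_coe, mem_filter] at hS ⊢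
        rw [hspikes, hspike]
        exact ⟨hmaps S hS.1, by tauto⟩
    have hsplit := card_filter_add_card_filter_not
      (s := {S ∈ (Icc 1 (n - 1)).powerset | J ⊆ setSpike n S}) (j ∈ setSpike n ·)
    rw [filter_filter, filter_filter, ← htoggle] at hsplit
    rw [card_insert_of_notMem hj, ← ih hJn, ← hsplit]
    simp only [insert_subset_iff, and_comm (a := j ∈ _)]
    ring

end Words

section Signs

variable {α : Type*} [AddCommGroup α] [LinearOrder α] {n : ℕ}

/-- Adjacent letters of `x_1 ⋯ x_n` have different absolute values. -/
def AbsSeparated (n : ℕ) (x : ℕ → α) : Prop :=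
  ∀ e, 1 ≤ e → e < n → |x e| ≠ |x (e + 1)|

/-- The position in `{e, e + 1}` of the letter with the larger absolute value. The sign of that
letter decides whether `e` is a descent. -/
def dominant (x : ℕ → α) (e : ℕ) : ℕ := if |x (e + 1)| < |x e| then e else e + 1

/-- The position in `{e, e + 1}` that is not dominant. -/
def recessive (x : ℕ → α) (e : ℕ) : ℕ := if |x (e + 1)| < |x e| then e + 1 else e

theorem dominant_congr {x z : ℕ → α} (h : |z| = |x|) : dominant z = dominant x := by
  have habs : ∀ j, |z j| = |x j| := congrFun h
  funext e
  simp only [dominant, habs]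

theorem mem_peaks_abs_iff_dominant {x : ℕ → α} (hx : AbsSeparated n x) {i : ℕ}
    (hi : 2 ≤ i ∧ i < n) :
    i ∈ peaks n |x| ↔ dominant x (i - 1) = i ∧ dominant x i = i := by
  have hi1 : i - 1 + 1 = i := by omega
  have hprev := (hx (i - 1) (by omega) (by omega)).symm
  rw [hi1] at hprev
  rw [mem_peaks, and_iff_right hi]
  simp only [dominant, Pi.abs_apply, hi1]
  refine and_congr ⟨fun h => if_neg h.not_gt, fun h => ?_⟩ ⟨fun h => if_pos h, fun h => ?_⟩ <;>
    split_ifs at h with hlt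
  · omega
  · exact (not_lt.1 hlt).lt_of_ne hprev.symm
  · exact hlt
  · omega

theorem mem_peaks_abs_of_dominant_eq {x : ℕ → α} (hx : AbsSeparated n x) {e f : ℕ} (he : 1 ≤ e)
    (hf : f < n) (hlt : e < f) (h : dominant x e = dominant x f) :
    f = e + 1 ∧ f ∈ peaks n |x| := by
  have hle : dominant x e ≤ e + 1 := by unfold dominant; split_ifs <;> omega
  have hge : f ≤ dominant x f := by unfold dominant; split_ifs <;> omega
  obtain rfl : f = e + 1 := by omega
  refine ⟨rfl, (mem_peaks_abs_iff_dominant hx ⟨by omega, hf⟩).2 ?_⟩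
  rw [Nat.add_sub_cancel]
  omega

/-- The word obtained from `x` by negating the letters whose signs decide the descents in `T`. -/
def switch (T : Finset ℕ) (x : ℕ → α) (j : ℕ) : α :=
  if j ∈ T.image (dominant x) then -x j else x j

theorem abs_switch (T : Finset ℕ) (x : ℕ → α) : |switch T x| = |x| := by
  funext j
  simp only [Pi.abs_apply, switch]
  split_ifs <;> simp

theorem switch_switch (T : Finset ℕ) (x : ℕ → α) : switch T (switch T x) = x := by
  funext j
  rw [switch, dominant_congr (abs_switch T x), switch]
  split_ifs <;> simp

variable [IsOrderedAddMonoid α]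

theorem lt_iff_pos_of_abs_lt {a b : α} (h : |b| < |a|) : b < a ↔ 0 < a := by
  refine ⟨fun hba => ?_, fun ha => (le_abs_self b).trans_lt (h.trans_eq (abs_of_pos ha))⟩
  by_contra! ha
  rw [abs_of_nonpos ha] at h
  exact (neg_lt_neg hba).not_ge ((neg_le_abs b).trans h.le)

theorem lt_iff_neg_of_abs_lt {a b : α} (h : |b| < |a|) : a < b ↔ a < 0 := by
  rw [← neg_lt_neg_iff, lt_iff_pos_of_abs_lt (by rwa [abs_neg, abs_neg]), neg_pos]

theorem ne_zero_of_abs_lt {a b : α} (h : |b| < |a|) : a ≠ 0 :=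
  abs_pos.1 ((abs_nonneg b).trans_lt h)

theorem peaks_abs_subset_setSpike (x : ℕ → α) : peaks n |x| ⊆ setSpike n (descents n x) := by
  intro i hi
  obtain ⟨hin, hprev, hnext⟩ := mem_peaks.1 hi
  simp only [Pi.abs_apply] at hprev hnext
  have hi1 : i - 1 + 1 = i := by omega
  rw [mem_setSpike, mem_descents, mem_descents, hi1, lt_iff_pos_of_abs_lt hnext,
    lt_iff_neg_of_abs_lt hprev]
  have hpos : 0 < x i ↔ ¬x i < 0 :=
    ⟨lt_asymm, fun h => (not_lt.1 h).lt_of_ne' (ne_zero_of_abs_lt hprev)⟩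
  have hbounds : (1 ≤ i ∧ i < n) ∧ 1 ≤ i - 1 ∧ i - 1 < n := by omega
  tauto

theorem apply_dominant_ne_zero {x : ℕ → α} {e : ℕ} (h : |x e| ≠ |x (e + 1)|) :
    x (dominant x e) ≠ 0 := by
  unfold dominant
  split_ifs with hlt
  · exact ne_zero_of_abs_lt hlt
  · exact ne_zero_of_abs_lt ((not_lt.1 hlt).lt_of_ne h)

theorem lt_succ_iff_iff_apply_dominant_eq {x z : ℕ → α} (hzx : |z| = |x|) {e : ℕ}
    (h : |x e| ≠ |x (e + 1)|) :
    (z (e + 1) < z e ↔ x (e + 1) < x e) ↔ z (dominant x e) = x (dominant x e) := by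
  have habs : ∀ j, |z j| = |x j| := congrFun hzx
  have hne := apply_dominant_ne_zero h
  unfold dominant at hne ⊢
  split_ifs at hne ⊢ with hlt
  · rw [lt_iff_pos_of_abs_lt hlt, lt_iff_pos_of_abs_lt (by rwa [habs, habs])]
    rcases abs_eq_abs.1 (habs e) with hz | hz <;> rw [hz]
    · simp
    · rcases hne.lt_or_gt with hx | hx <;> simp [hx, hx.le, hne, neg_eq_self]
  · have hlt' : |x e| < |x (e + 1)| := (not_lt.1 hlt).lt_of_ne h
    rw [lt_iff_neg_of_abs_lt hlt', lt_iff_neg_of_abs_lt (by rwa [habs, habs])]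
    rcases abs_eq_abs.1 (habs (e + 1)) with hz | hz <;> rw [hz]
    · simp
    · rcases hne.lt_or_gt with hx | hx <;> simp [hx, hx.le, hne, neg_eq_self]

theorem descents_eq_symmDiff {x z : ℕ → α} {T : Finset ℕ} (hx : AbsSeparated n x) (hzx : |z| = |x|)
    (hT : T ⊆ Icc 1 (n - 1))
    (hsign : ∀ e, 1 ≤ e → e < n → (z (dominant x e) ≠ x (dominant x e) ↔ e ∈ T)) :
    descents n z = descents n x ∆ T := by
  ext e
  rw [mem_symmDiff, mem_descents, mem_descents]
  by_cases he : 1 ≤ e ∧ e < n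
  · have hiff := lt_succ_iff_iff_apply_dominant_eq hzx (hx e he.1 he.2)
    have hT := hsign e he.1 he.2
    tauto
  · have heT : e ∉ T := fun h => he (by have := mem_Icc.1 (hT h); omega)
    tauto

theorem descents_switch {T : Finset ℕ} {x : ℕ → α} (hx : AbsSeparated n x)
    (hT : T ⊆ Icc 1 (n - 1)) (hpeaks : ∀ i ∈ peaks n |x|, (i - 1 ∈ T ↔ i ∈ T)) :
    descents n (switch T x) = descents n x ∆ T := by
  refine descents_eq_symmDiff hx (abs_switch T x) hT fun e he hen => ?_
  have hmem : dominant x e ∈ T.image (dominant x) ↔ e ∈ T := by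
    refine ⟨fun h => ?_, mem_image_of_mem _⟩
    obtain ⟨f, hfT, hfe⟩ := mem_image.1 h
    have hf := mem_Icc.1 (hT hfT)
    rcases lt_trichotomy e f with hlt | rfl | hlt
    · obtain ⟨rfl, hpeak⟩ := mem_peaks_abs_of_dominant_eq hx he (by omega) hlt hfe.symm
      exact (hpeaks _ hpeak).2 hfT
    · exact hfT
    · obtain ⟨rfl, hpeak⟩ := mem_peaks_abs_of_dominant_eq hx hf.1 hen hlt hfe
      exact (hpeaks _ hpeak).1 hfT
  rw [← hmem, switch]
  split_ifs with h
  · simpa [h, neg_eq_self] using apply_dominant_ne_zero (hx e he hen)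
  · simp [h]

end Signs

section SignClosed

variable {α Ω : Type*} [AddCommGroup α] [LinearOrder α] {n : ℕ}

/-- The word `x_1 ⋯ x_n` has the descent set `S_I`, and its absolute values have a peak at every
spike. For the code of a permutation this says that no spike can be flipped away, see
`mem_descentClass_and_forall_not_admitsFlip_iff`. -/
def IsFlipFree (n : ℕ) (I : Finset ℕ) (x : ℕ → α) : Prop :=
  descents n x = spikeDescents I ∧ peaks n |x| = I

instance (n : ℕ) (I : Finset ℕ) (x : ℕ → α) : Decidable (IsFlipFree n I x) :=
  inferInstanceAs (Decidable (_ ∧ _))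

/-- A family of distinct words that is closed under changes of the signs of the letters, and in
which adjacent letters among the first `n` have different absolute values. -/
structure IsSignClosed (n : ℕ) (x : Ω → ℕ → α) : Prop where
  injective : Function.Injective x
  absSeparated : ∀ ω, AbsSeparated n (x ω)
  mem_range_of_abs_eq : ∀ ω z, |z| = |x ω| → z ∈ Set.range x

namespace IsSignClosed

variable [IsOrderedAddMonoid α] [Fintype Ω] {x : Ω → ℕ → α}

theorem card_descents_and_peaks_eq (h : IsSignClosed n x) {S S' J : Finset ℕ}
    (hS : S ⊆ Icc 1 (n - 1)) (hJ : J ⊆ setSpike n S) (hS' : S' ⊆ Icc 1 (n - 1))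
    (hJ' : J ⊆ setSpike n S') :
    #{ω | descents n (x ω) = S ∧ peaks n |x ω| = J} =
      #{ω | descents n (x ω) = S' ∧ peaks n |x ω| = J} := by
  choose f hf using fun ω => h.mem_range_of_abs_eq ω _ (abs_switch (S ∆ S') (x ω))
  have hf_invol : ∀ ω, f (f ω) = ω := fun ω => h.injective <| by rw [hf, hf, switch_switch]
  have hT : S ∆ S' ⊆ Icc 1 (n - 1) := symmDiff_le_sup.trans (union_subset hS hS')
  have hpeaks : ∀ i ∈ J, (i - 1 ∈ S ∆ S' ↔ i ∈ S ∆ S') := fun i hi => by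
    have hiS := (mem_setSpike.1 (hJ hi)).2
    have hiS' := (mem_setSpike.1 (hJ' hi)).2
    rw [mem_symmDiff, mem_symmDiff]
    tauto
  have hdescents : ∀ ω, peaks n |x ω| = J → descents n (x (f ω)) = descents n (x ω) ∆ (S ∆ S') :=
    fun ω hω => by rw [hf, descents_switch (h.absSeparated ω) hT (hω.symm ▸ hpeaks)]
  refine card_nbij' f f (fun ω hω => ?_) (fun ω hω => ?_) (fun ω _ => hf_invol ω)
    (fun ω _ => hf_invol ω) <;>
  · obtain ⟨hSω, hJω⟩ := (mem_filter.1 (mem_coe.1 hω)).2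
    refine mem_coe.2 (mem_filter.2 ⟨mem_univ _, ?_, by rw [hf, abs_switch, hJω]⟩)
    rw [hdescents ω hJω, hSω]
    simp only [symmDiff_symmDiff_cancel_left, symmDiff_comm S', symmDiff_symmDiff_cancel_right]

theorem card_descents_eq_sum (h : IsSignClosed n x) {I : Finset ℕ} (hI : I ⊆ Icc 2 (n - 1)) :
    #{ω | descents n (x ω) = spikeDescents I} =
      ∑ J ∈ I.powerset, #{ω | IsFlipFree n J (x ω)} := by
  obtain ⟨hS, hspike⟩ := spikeDescents_subset_and_setSpike_eq hI
  rw [card_eq_sum_card_fiberwise (f := fun ω => peaks n |x ω|) (t := I.powerset)]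
  · refine sum_congr rfl fun J hJ => ?_
    have hJI := mem_powerset.1 hJ
    obtain ⟨hS', hspike'⟩ := spikeDescents_subset_and_setSpike_eq (hJI.trans hI)
    rw [filter_filter]
    exact h.card_descents_and_peaks_eq hS (by rwa [hspike]) hS' hspike'.ge
  · intro ω hω
    rw [mem_coe, mem_filter] at hω
    rw [mem_coe, mem_powerset, ← hspike, ← hω.2]
    exact peaks_abs_subset_setSpike _

theorem two_pow_mul_card_peaks_eq (h : IsSignClosed n x) {J : Finset ℕ} (hJ : J ⊆ Icc 2 (n - 1)) :
    2 ^ #J * #{ω | peaks n |x ω| = J} = 2 ^ (n - 1) * #{ω | IsFlipFree n J (x ω)} := by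
  obtain ⟨hS, hspike⟩ := spikeDescents_subset_and_setSpike_eq hJ
  rw [← two_pow_mul_card_subset_setSpike hJ, mul_assoc, card_eq_sum_card_fiberwise
    (f := fun ω => descents n (x ω)) (t := {S ∈ (Icc 1 (n - 1)).powerset | J ⊆ setSpike n S}),
    ← smul_eq_mul (a := #(filter _ (powerset _))), ← sum_const]
  · refine congrArg _ (sum_congr rfl fun S hS' => ?_)
    obtain ⟨hSn, hJS⟩ := mem_filter.1 hS'
    simp only [filter_filter, and_comm (a := peaks n _ = J)]
    exact h.card_descents_and_peaks_eq (mem_powerset.1 hSn) hJS hS hspike.ge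
  · intro ω hω
    rw [mem_coe, mem_filter] at hω
    rw [mem_coe, mem_filter, mem_powerset]
    exact ⟨descents_subset _ _, hω.2 ▸ peaks_abs_subset_setSpike _⟩

theorem card_isFlipFree_eq_mul {β Ω' : Type*} [AddCommGroup β] [LinearOrder β]
    [IsOrderedAddMonoid β] [Fintype Ω'] {y : Ω' → ℕ → β} (hx : IsSignClosed n x)
    (hy : IsSignClosed n y) {c : ℕ}
    (hc : ∀ S, #{ω | descents n (y ω) = S} = c * #{ω | descents n (x ω) = S}) {I : Finset ℕ}
    (hI : I ⊆ Icc 2 (n - 1)) :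
    #{ω | IsFlipFree n I (y ω)} = c * #{ω | IsFlipFree n I (x ω)} := by
  induction I using Finset.strongInduction with
  | H I ih =>
    have hsum := hc (spikeDescents I)
    rw [hx.card_descents_eq_sum hI, hy.card_descents_eq_sum hI, mul_sum,
      ← add_sum_erase _ _ (mem_powerset_self I), ← add_sum_erase _ _ (mem_powerset_self I)] at hsum
    refine Nat.add_right_cancel (hsum.trans (congrArg _ (sum_congr rfl fun J hJ => ?_)).symm)
    have hJI := mem_powerset.1 (mem_of_mem_erase hJ)
    exact ih J (hJI.ssubset_of_ne (ne_of_mem_erase hJ)) (hJI.trans hI)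

end IsSignClosed

end SignClosed

section Code

open Equiv (Perm)

variable {n : ℕ} {σ τ : Perm (Fin n)} {i j : ℕ}

theorem val_of_mem_Icc (σ : Perm (Fin n)) (hj : 1 ≤ j ∧ j ≤ n) :
    val σ j = (σ ⟨j - 1, by omega⟩ : ℕ) + 1 := dif_pos hj

theorem val_of_notMem_Icc (σ : Perm (Fin n)) (hj : ¬(1 ≤ j ∧ j ≤ n)) : val σ j = 0 := dif_neg hj

theorem val_fin_succ (σ : Perm (Fin n)) (p : Fin n) : val σ (p + 1) = (σ p : ℕ) + 1 :=
  val_of_mem_Icc σ (by omega)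

theorem val_mem_Icc (σ : Perm (Fin n)) (hj : 1 ≤ j ∧ j ≤ n) : val σ j ∈ Icc 1 n := by
  rw [val_of_mem_Icc σ hj, mem_Icc]
  omega

theorem val_inj (hi : 1 ≤ i ∧ i ≤ n) (hj : 1 ≤ j ∧ j ≤ n) : val σ i = val σ j ↔ i = j := by
  rw [val_of_mem_Icc σ hi, val_of_mem_Icc σ hj, Nat.add_right_cancel_iff, Fin.val_inj,
    σ.injective.eq_iff, Fin.mk.injEq]
  omega

theorem eq_of_forall_val_eq (h : ∀ j ≤ n, val σ j = val τ j) : σ = τ := by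
  ext p
  simpa only [val_fin_succ, Nat.add_right_cancel_iff] using h (p + 1) (by omega)

theorem mem_init {v : ℕ} : v ∈ init j σ ↔ ∃ i, (1 ≤ i ∧ i ≤ j) ∧ val σ i = v := by
  simp only [init, mem_image, mem_Icc]

theorem val_mem_init (hi : 1 ≤ i ∧ i ≤ j) : val σ i ∈ init j σ := mem_init.2 ⟨i, hi, rfl⟩

theorem val_notMem_init (hj : j < n) : val σ (j + 1) ∉ init j σ := fun h => by
  obtain ⟨i, hi, hval⟩ := mem_init.1 h
  rw [val_inj (by omega) (by omega)] at hval
  omega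

theorem init_succ (σ : Perm (Fin n)) (j : ℕ) :
    init (j + 1) σ = insert (val σ (j + 1)) (init j σ) := by
  rw [init, init, ← insert_Icc_right_eq_Icc_add_one (by omega), image_insert]

theorem injOn_val (hj : j ≤ n) : Set.InjOn (val σ) (Icc 1 j : Finset ℕ) := fun a ha b hb hab => by
  rw [mem_coe, mem_Icc] at ha hb
  exact (val_inj (by omega) (by omega)).1 hab

theorem card_init (hj : j ≤ n) : #(init j σ) = j := by
  rw [init, card_image_of_injOn (injOn_val hj), Nat.card_Icc, Nat.add_sub_cancel]

theorem init_subset (hj : j ≤ n) : init j σ ⊆ Icc 1 n := fun v hv => by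
  obtain ⟨i, hi, rfl⟩ := mem_init.1 hv
  exact val_mem_Icc σ (by omega)

theorem init_self (σ : Perm (Fin n)) : init n σ = Icc 1 n :=
  eq_of_subset_of_card_le (init_subset le_rfl) (by simp [card_init])

theorem spike_eq_setSpike (σ : Perm (Fin n)) : spike σ = setSpike n (des σ) := by
  ext i
  simp only [spike, peak, valley, mem_union, mem_filter, mem_Icc, mem_setSpike, des]
  by_cases hi : 2 ≤ i ∧ i ≤ n - 1
  · have hnext : val σ (i + 1) ≠ val σ i := fun h => by
      rw [val_inj (by omega) (by omega)] at h
      omega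
    have hprev : val σ (i - 1) ≠ val σ i := fun h => by
      rw [val_inj (by omega) (by omega)] at h
      omega
    rw [Nat.sub_add_cancel (by omega)]
    omega
  · exact iff_of_false (by tauto) (by omega)

/-- The code of `σ`, in a symmetric normalization that makes flips act by changes of signs: its
`j`-th letter is `#{i < j : σ_i < σ_j} - #{i < j : σ_i > σ_j}`, and `0` for `j > n`. -/
def code (σ : Perm (Fin n)) (j : ℕ) : ℤ :=
  if j ≤ n then ∑ i ∈ Ico 1 j, if val σ i < val σ j then 1 else -1 else 0

theorem code_of_le (σ : Perm (Fin n)) (hj : j ≤ n) :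
    code σ j = ∑ i ∈ Ico 1 j, if val σ i < val σ j then 1 else -1 := if_pos hj

theorem code_of_lt (σ : Perm (Fin n)) (hj : n < j) : code σ j = 0 := if_neg hj.not_ge

theorem code_zero (σ : Perm (Fin n)) : code σ 0 = 0 := by simp [code]

theorem code_succ (σ : Perm (Fin n)) (hj : j < n) :
    code σ (j + 1) = 2 * #{v ∈ init j σ | v < val σ (j + 1)} - j := by
  have hsum : (j : ℤ) = ∑ _v ∈ init j σ, 1 := by rw [sum_const, card_init hj.le]; simp
  have hIcc : Ico 1 (j + 1) = Icc 1 j := rfl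
  rw [code_of_le σ hj, hIcc, ← sum_image (f := fun v => if v < val σ (j + 1) then (1 : ℤ) else -1)
    (injOn_val hj.le), card_filter, Nat.cast_sum, mul_sum, hsum, ← sum_sub_distrib]
  refine sum_congr rfl fun v _ => ?_
  split_ifs <;> simp

theorem code_succ_lt_iff (hj : 1 ≤ j) (hjn : j < n) :
    code σ (j + 1) < code σ j ↔ val σ (j + 1) < val σ j := by
  have hne : val σ (j + 1) ≠ val σ j := fun h => by
    rw [val_inj (by omega) (by omega)] at h
    omega
  rw [code_of_le σ (by omega : j + 1 ≤ n), code_of_le σ hjn.le, sum_Ico_succ_top hj]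
  rcases hne.lt_or_gt with h | h
  · refine iff_of_true ?_ h
    rw [if_neg h.not_gt]
    have : ∑ i ∈ Ico 1 j, (if val σ i < val σ (j + 1) then (1 : ℤ) else -1) ≤
        ∑ i ∈ Ico 1 j, if val σ i < val σ j then 1 else -1 :=
      sum_le_sum fun i _ => by split_ifs <;> omega
    omega
  · refine iff_of_false (fun hlt => ?_) h.not_gt
    rw [if_pos h] at hlt
    have : ∑ i ∈ Ico 1 j, (if val σ i < val σ j then (1 : ℤ) else -1) ≤
        ∑ i ∈ Ico 1 j, if val σ i < val σ (j + 1) then 1 else -1 :=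
      sum_le_sum fun i _ => by split_ifs <;> omega
    omega

theorem des_eq_descents_code (σ : Perm (Fin n)) : des σ = descents n (code σ) := by
  refine filter_congr fun j hj => ?_
  have hj := mem_Icc.1 hj
  exact (code_succ_lt_iff hj.1 (by omega)).symm

theorem absSeparated_code (σ : Perm (Fin n)) : AbsSeparated n (code σ) := by
  intro e he hen habs
  obtain ⟨e, rfl⟩ : ∃ d, e = d + 1 := ⟨e - 1, by omega⟩
  rw [code_succ σ hen, code_succ σ (by omega : e < n)] at habs
  -- The two letters have different parities.
  rcases abs_eq_abs.1 habs with h | h <;> push_cast at h <;> omega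

theorem eq_of_card_filter_lt_eq {α : Type*} [LinearOrder α] {A : Finset α} {a b : α} (ha : a ∈ A)
    (hb : b ∈ A) (h : #{v ∈ A | v < a} = #{v ∈ A | v < b}) : a = b := by
  have hlt : ∀ a b, a ∈ A → a < b → #{v ∈ A | v < a} < #{v ∈ A | v < b} := fun a b ha hab =>
    card_lt_card <| (ssubset_iff_of_subset (monotone_filter_right A fun v _ hv => hv.trans hab)).2
      ⟨a, mem_filter.2 ⟨ha, hab⟩, by simp⟩
  rcases lt_trichotomy a b with hab | hab | hab
  · exact absurd h (hlt a b ha hab).ne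
  · exact hab
  · exact absurd h (hlt b a hb hab).ne'

/-- Reading from right to left, each letter of the code gives the rank of an entry among the
entries that are still to be placed. -/
theorem val_eq_of_init_eq_of_code_eq {m : ℕ} (hm : m ≤ n) (hinit : init m σ = init m τ)
    (hcode : ∀ j ≤ m, code σ j = code τ j) : ∀ j ≤ m, val σ j = val τ j := by
  induction m with
  | zero =>
    intro j hj
    rw [val_of_notMem_Icc σ (by omega), val_of_notMem_Icc τ (by omega)]
  | succ m ih =>
    have hrank : ∀ ρ : Perm (Fin n),
        #{v ∈ init (m + 1) ρ | v < val ρ (m + 1)} = #{v ∈ init m ρ | v < val ρ (m + 1)} :=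
      fun ρ => by rw [init_succ, filter_insert, if_neg (lt_irrefl _)]
    have hlast : val σ (m + 1) = val τ (m + 1) := by
      refine eq_of_card_filter_lt_eq (A := init (m + 1) σ) (val_mem_init (by omega))
        (hinit ▸ val_mem_init (by omega)) ?_
      have hletter := hcode (m + 1) le_rfl
      rw [code_succ σ hm, code_succ τ hm] at hletter
      rw [hrank, hinit, hrank]
      omega
    have hinit' : init m σ = init m τ := by
      rw [← erase_insert (val_notMem_init (σ := σ) hm), ← init_succ, hinit, hlast, init_succ,
        erase_insert (val_notMem_init hm)]
    intro j hj
    rcases Nat.le_succ_iff.1 hj with hj | rfl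
    · exact ih (by omega) hinit' (fun j hj => hcode j (by omega)) j hj
    · exact hlast

theorem code_injective : Function.Injective (code (n := n)) := fun σ τ h =>
  eq_of_forall_val_eq <| val_eq_of_init_eq_of_code_eq le_rfl (by rw [init_self, init_self])
    fun j _ => congrFun h j

end Code

section Flip

open Equiv (Perm)

variable {n : ℕ} {i j k : ℕ}

theorem reverseOn_of_notMem {A : Finset (Fin n)} {a : Fin n} (h : a ∉ A) : reverseOn A a = a :=
  Perm.ofSubtype_apply_of_not_mem _ h

theorem reverseOn_mem {A : Finset (Fin n)} {a : Fin n} (h : a ∈ A) : reverseOn A a ∈ A := by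
  rw [reverseOn, Perm.ofSubtype_apply_of_mem _ h]
  exact Subtype.prop _

theorem reverseOn_lt_iff {A : Finset (Fin n)} {a b : Fin n} (ha : a ∈ A) (hb : b ∈ A) :
    reverseOn A a < reverseOn A b ↔ b < a := by
  rw [reverseOn, Perm.ofSubtype_apply_of_mem _ ha, Perm.ofSubtype_apply_of_mem _ hb]
  simp

theorem val_fl_of_lt (σ : Perm (Fin n)) (hij : i < j) : val (fl i σ) j = val σ j := by
  by_cases hj : 1 ≤ j ∧ j ≤ n
  · rw [val_of_mem_Icc _ hj, val_of_mem_Icc _ hj, fl, Perm.mul_apply, reverseOn_of_notMem]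
    rw [σ.injective.mem_finset_image, mem_filter]
    simp only [mem_univ, true_and]
    omega
  · rw [val_of_notMem_Icc _ hj, val_of_notMem_Icc _ hj]

theorem val_fl_lt_iff (σ : Perm (Fin n)) (hj : 1 ≤ j ∧ j ≤ n) (hji : j ≤ i) (hk : 1 ≤ k ∧ k ≤ n)
    (hki : k ≤ i) : val (fl i σ) j < val (fl i σ) k ↔ val σ k < val σ j := by
  rw [val_of_mem_Icc _ hj, val_of_mem_Icc _ hj, val_of_mem_Icc _ hk, val_of_mem_Icc _ hk, fl,
    Perm.mul_apply, Perm.mul_apply, Nat.add_lt_add_iff_right, Nat.add_lt_add_iff_right,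
    Fin.val_fin_lt, Fin.val_fin_lt, reverseOn_lt_iff]
  all_goals exact mem_image_of_mem _ (mem_filter.2 ⟨mem_univ _, by simp only; omega⟩)

theorem val_fl_mem_init (σ : Perm (Fin n)) (hj : 1 ≤ j ∧ j ≤ n) (hji : j ≤ i) :
    val (fl i σ) j ∈ init i σ := by
  have hmem : fl i σ ⟨j - 1, by omega⟩ ∈ (univ.filter fun p : Fin n => (p : ℕ) < i).image σ :=
    reverseOn_mem (mem_image_of_mem _ (mem_filter.2 ⟨mem_univ _, by simp only; omega⟩))
  obtain ⟨p, hp, hval⟩ := mem_image.1 hmem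
  rw [val_of_mem_Icc _ hj, ← hval, ← val_fin_succ]
  exact val_mem_init (by have := (mem_filter.1 hp).2; omega)

theorem init_fl (σ : Perm (Fin n)) (hik : i ≤ k) (hk : k ≤ n) : init k (fl i σ) = init k σ := by
  refine eq_of_subset_of_card_le (fun v hv => ?_) (by rw [card_init hk, card_init hk])
  obtain ⟨j, hj, rfl⟩ := mem_init.1 hv
  rcases lt_or_ge i j with hij | hji
  · exact val_fl_of_lt σ hij ▸ val_mem_init hj
  · exact image_subset_image (Icc_subset_Icc_right hik) (val_fl_mem_init σ (by omega) hji)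

theorem code_fl (σ : Perm (Fin n)) (i j : ℕ) :
    code (fl i σ) j = if j ≤ i then -code σ j else code σ j := by
  rcases lt_or_ge n j with hj | hj
  · simp [code_of_lt _ hj]
  split_ifs with hji
  · rw [code_of_le _ hj, code_of_le _ hj, ← sum_neg_distrib]
    refine sum_congr rfl fun k hk => ?_
    have hk := mem_Ico.1 hk
    have hne : val σ k ≠ val σ j := fun h => by
      rw [val_inj (by omega) (by omega)] at h
      omega
    rw [if_congr (val_fl_lt_iff σ (by omega) (by omega) (by omega) hji) rfl rfl]
    split_ifs <;> omega
  · obtain ⟨j, rfl⟩ : ∃ d, j = d + 1 := ⟨j - 1, by omega⟩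
    rw [code_succ _ hj, code_succ _ hj, init_fl σ (by omega) (by omega), val_fl_of_lt σ (by omega)]

theorem abs_code_fl (σ : Perm (Fin n)) (i : ℕ) : |code (fl i σ)| = |code σ| := by
  funext j
  rw [Pi.abs_apply, Pi.abs_apply, code_fl]
  split_ifs <;> simp

/-- `fl_j ∘ fl_{j-1}` negates the `j`-th letter of the code alone. -/
theorem isSignClosed_code (n : ℕ) : IsSignClosed n (code (n := n)) where
  injective := code_injective
  absSeparated := absSeparated_code
  mem_range_of_abs_eq σ z hz := by
    have hsigns : ∀ N, ∃ τ : Perm (Fin n), |code τ| = |z| ∧ ∀ j ≤ N, code τ j = z j := fun N => by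
      induction N with
      | zero =>
        have hzero := congrFun hz 0
        rw [Pi.abs_apply, Pi.abs_apply, code_zero, abs_zero, abs_eq_zero] at hzero
        exact ⟨σ, hz.symm, fun j hj => by rw [Nat.le_zero.1 hj, code_zero, hzero]⟩
      | succ N ih =>
        obtain ⟨τ, habs, hτ⟩ := ih
        rcases abs_eq_abs.1 (congrFun habs (N + 1)) with hlast | hlast
        · exact ⟨τ, habs, fun j hj => (Nat.le_succ_iff.1 hj).elim (hτ j) fun h => h ▸ hlast⟩
        · refine ⟨fl (N + 1) (fl N τ), by rw [abs_code_fl, abs_code_fl, habs], fun j hj => ?_⟩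
          rw [code_fl, code_fl, if_pos hj]
          split_ifs with hjN
          · rw [neg_neg, hτ j hjN]
          · obtain rfl : j = N + 1 := by omega
            rw [hlast, neg_neg]
    obtain ⟨τ, habs, hτ⟩ := hsigns n
    refine ⟨τ, funext fun j => (le_or_gt j n).elim (hτ j) fun hj => ?_⟩
    have hzero := congrFun habs j
    rw [Pi.abs_apply, Pi.abs_apply, code_of_lt τ hj, abs_zero, eq_comm, abs_eq_zero] at hzero
    rw [code_of_lt τ hj, hzero]

theorem des_fl (σ : Perm (Fin n)) (hk : 1 ≤ k ∧ k < n) :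
    des (fl k σ) = des σ ∆ Ico 1 (recessive (code σ) k) := by
  have hrec : recessive (code σ) k = k ∨ recessive (code σ) k = k + 1 := by
    unfold recessive
    split_ifs <;> simp
  rw [des_eq_descents_code, des_eq_descents_code]
  refine descents_eq_symmDiff (absSeparated_code σ) (abs_code_fl σ k) (fun e he => ?_)
    fun e he hen => ?_
  · rw [mem_Ico] at he
    rw [mem_Icc]
    omega
  · have hne := apply_dominant_ne_zero (absSeparated_code σ e he hen)
    have hdominant : dominant (code σ) e ≤ k ↔ e < recessive (code σ) k := by
      rcases lt_trichotomy e k with h | rfl | h <;> unfold dominant recessive <;> split_ifs <;>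
        omega
    rw [code_fl, mem_Ico, and_iff_right he, ← hdominant]
    split_ifs <;> omega

theorem spike_fl_eq_sdiff_iff (σ : Perm (Fin n)) (hi : i ∈ spike σ) (hk : 1 ≤ k ∧ k < n) :
    spike (fl k σ) = spike σ \ {i} ↔ i = recessive (code σ) k := by
  have htoggle : ∀ j, 2 ≤ j ∧ j < n →
      (j ∈ spike (fl k σ) ↔ ¬(j ∈ spike σ ↔ j = recessive (code σ) k)) := fun j hj => by
    rw [spike_eq_setSpike, spike_eq_setSpike, des_fl σ hk, mem_setSpike_symmDiff_Ico hj]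
  have hrange : ∀ (τ : Perm (Fin n)) j, j ∈ spike τ → 2 ≤ j ∧ j < n := fun τ j hj => by
    rw [spike_eq_setSpike] at hj
    exact (mem_setSpike.1 hj).1
  constructor
  · intro h
    have hi' := htoggle i (hrange σ i hi)
    rw [h, mem_sdiff, mem_singleton] at hi'
    tauto
  · rintro rfl
    ext j
    rw [mem_sdiff, mem_singleton]
    by_cases hj : 2 ≤ j ∧ j < n
    · rw [htoggle j hj]
      by_cases hji : j = recessive (code σ) k
      · simp [hji, hi]
      · simp [hji]
    · exact iff_of_false (fun h => hj (hrange _ _ h)) fun h => hj (hrange _ _ h.1)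

theorem admitsFlip_iff (σ : Perm (Fin n)) (i : ℕ) :
    AdmitsFlip σ i ↔ i ∈ spike σ ∧ i ∉ peaks n |code σ| := by
  rw [AdmitsFlip, AdmitsFlipPlus, AdmitsFlipMinus, ← and_or_left]
  refine and_congr_right fun hi => ?_
  have hin : 2 ≤ i ∧ i < n := (mem_setSpike.1 (spike_eq_setSpike σ ▸ hi)).1
  rw [spike_fl_eq_sdiff_iff σ hi (by omega), spike_fl_eq_sdiff_iff σ hi (by omega),
    mem_peaks_abs_iff_dominant (absSeparated_code σ) hin]
  unfold recessive dominant
  split_ifs <;> omega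

theorem mem_descentClass_and_forall_not_admitsFlip_iff {I : Finset ℕ} (hI : I ⊆ Icc 2 (n - 1))
    (σ : Perm (Fin n)) :
    (σ ∈ descentClass (spikeDescents I) n ∧ ∀ i, ¬AdmitsFlip σ i) ↔ IsFlipFree n I (code σ) := by
  rw [descentClass, mem_filter, and_iff_right (mem_univ σ), IsFlipFree, ← des_eq_descents_code]
  refine and_congr_right fun hdes => ?_
  have hspike : spike σ = I := by
    rw [spike_eq_setSpike, hdes, (spikeDescents_subset_and_setSpike_eq hI).2]
  have hpeaks : peaks n |code σ| ⊆ I := by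
    rw [← hspike, spike_eq_setSpike, des_eq_descents_code]
    exact peaks_abs_subset_setSpike _
  simp only [admitsFlip_iff, hspike, not_and, not_not]
  exact ⟨fun h => hpeaks.antisymm h, fun h => h.ge⟩

end Flip

section SignedWord

open Equiv (Perm)

variable {n : ℕ} {j : ℕ}

theorem exists_perm_lt_iff_lt {α : Type*} [LinearOrder α] {f : Fin n → α}
    (hf : Function.Injective f) : ∃ π : Perm (Fin n), ∀ p q, π p < π q ↔ f p < f q := by
  have hsort : StrictMono (f ∘ Tuple.sort f) :=
    (Tuple.monotone_sort f).strictMono_of_injective (hf.comp (Tuple.sort f).injective)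
  refine ⟨(Tuple.sort f)⁻¹, fun p q => ?_⟩
  rw [← hsort.lt_iff_lt]
  simp

/-- The integer `v`, negated if `v ∈ V`. -/
def negateOn (V : Finset ℕ) (v : ℕ) : ℤ := if v ∈ V then -v else v

theorem abs_negateOn (V : Finset ℕ) (v : ℕ) : |negateOn V v| = v := by
  unfold negateOn
  split_ifs <;> simp

theorem negateOn_injective (V : Finset ℕ) : Function.Injective (negateOn V) := fun v w h => by
  have habs := congrArg abs h
  rwa [abs_negateOn, abs_negateOn, Nat.cast_inj] at habs

theorem negateOn_neg_iff (V : Finset ℕ) {v : ℕ} (hv : 1 ≤ v) : negateOn V v < 0 ↔ v ∈ V := by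
  unfold negateOn
  split_ifs with h
  · exact iff_of_true (by omega) h
  · exact iff_of_false (by omega) h

/-- The word of a signed permutation, given by a permutation and the set of its negated values. -/
def signedWord (ω : Perm (Fin n) × (Icc 1 n).powerset) (j : ℕ) : ℤ :=
  negateOn ω.2 (val ω.1 j)

theorem abs_signedWord (ω : Perm (Fin n) × (Icc 1 n).powerset) :
    |signedWord ω| = fun j => (val ω.1 j : ℤ) :=
  funext fun _ => abs_negateOn _ _

theorem peaks_abs_signedWord (ω : Perm (Fin n) × (Icc 1 n).powerset) :
    peaks n |signedWord ω| = peak ω.1 := by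
  simp only [abs_signedWord, peaks, peak, Nat.cast_lt]

theorem signedWord_injective : Function.Injective (signedWord (n := n)) := by
  rintro ⟨σ, V, hV⟩ ⟨τ, W, hW⟩ h
  have hval : ∀ j, val σ j = val τ j := fun j => by
    have habs := congrArg abs (congrFun h j)
    simpa only [signedWord, abs_negateOn, Nat.cast_inj] using habs
  obtain rfl : σ = τ := eq_of_forall_val_eq fun j _ => hval j
  have hVW : V = W := by
    ext v
    by_cases hv : v ∈ Icc 1 n
    · obtain ⟨j, -, rfl⟩ := mem_init.1 (init_self σ ▸ hv)
      have hpos := (mem_Icc.1 hv).1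
      rw [← negateOn_neg_iff V hpos, ← negateOn_neg_iff W hpos]
      exact iff_of_eq (congrArg (· < 0) (congrFun h j))
    · exact iff_of_false (fun h => hv (mem_powerset.1 hV h)) fun h => hv (mem_powerset.1 hW h)
  subst hVW
  rfl

theorem isSignClosed_signedWord (n : ℕ) : IsSignClosed n (signedWord (n := n)) where
  injective := signedWord_injective
  absSeparated ω e he hen h := by
    rw [signedWord, signedWord, abs_negateOn, abs_negateOn, Nat.cast_inj,
      val_inj (by omega) (by omega)] at h
    omega
  mem_range_of_abs_eq := by
    rintro ⟨σ, V⟩ z hz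
    rw [abs_signedWord] at hz
    have habs : ∀ j, |z j| = val σ j := congrFun hz
    refine ⟨(σ, ⟨{j ∈ Icc 1 n | z j < 0}.image (val σ), mem_powerset.2 ?_⟩), funext fun j => ?_⟩
    · exact image_subset_iff.2 fun j hj => val_mem_Icc σ (mem_Icc.1 (mem_filter.1 hj).1)
    by_cases hj : 1 ≤ j ∧ j ≤ n
    · have hmem : val σ j ∈ ({j ∈ Icc 1 n | z j < 0}.image (val σ)) ↔ z j < 0 := by
        refine ⟨fun h => ?_, fun h => mem_image_of_mem _ (mem_filter.2 ⟨mem_Icc.2 hj, h⟩)⟩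
        obtain ⟨k, hk, hval⟩ := mem_image.1 h
        rw [mem_filter, mem_Icc] at hk
        exact (val_inj hk.1 hj).1 hval ▸ hk.2
      simp only [signedWord, negateOn, hmem, ← habs]
      split_ifs with h
      · rw [abs_of_neg h, neg_neg]
      · exact abs_of_nonneg (not_lt.1 h)
    · have hzero := habs j
      rw [val_of_notMem_Icc σ hj, Nat.cast_zero, abs_eq_zero] at hzero
      simp [signedWord, negateOn, val_of_notMem_Icc σ hj, hzero]

theorem exists_descents_signedWord_eq (V : (Icc 1 n).powerset) :
    ∃ ρ : Perm (Fin n), ∀ σ, descents n (signedWord (σ, V)) = des (ρ * σ) := by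
  obtain ⟨ρ, hρ⟩ := exists_perm_lt_iff_lt (f := fun a : Fin n => negateOn V (a + 1)) fun a b h =>
    Fin.ext (Nat.add_right_cancel (negateOn_injective V h))
  refine ⟨ρ, fun σ => filter_congr fun j hj => ?_⟩
  have hj := mem_Icc.1 hj
  have hrange : (1 ≤ j ∧ j ≤ n) ∧ 1 ≤ j + 1 ∧ j + 1 ≤ n := by omega
  rw [val_of_mem_Icc _ hrange.1, val_of_mem_Icc _ hrange.2, Nat.add_lt_add_iff_right,
    Fin.val_fin_lt, Perm.mul_apply, Perm.mul_apply, hρ, signedWord, signedWord,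
    val_of_mem_Icc _ hrange.1, val_of_mem_Icc _ hrange.2]

theorem card_filter_prod_powerset {P : Perm (Fin n) × (Icc 1 n).powerset → Prop}
    [DecidablePred P] {N : ℕ} (h : ∀ V, #{σ | P (σ, V)} = N) : #{ω | P ω} = 2 ^ n * N := by
  simp only [card_filter] at h ⊢
  rw [Fintype.sum_prod_type_right]
  simp [h]

theorem card_descents_signedWord (S : Finset ℕ) :
    #{ω | descents n (signedWord (n := n) ω) = S} =
      2 ^ n * #{σ : Perm (Fin n) | descents n (code σ) = S} := by
  refine card_filter_prod_powerset fun V => ?_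
  obtain ⟨ρ, hρ⟩ := exists_descents_signedWord_eq V
  simp only [hρ, des_eq_descents_code, card_filter]
  exact Equiv.sum_comp (Equiv.mulLeft ρ) fun σ => if descents n (code σ) = S then 1 else 0

theorem card_peaks_signedWord (I : Finset ℕ) :
    #{ω | peaks n |signedWord (n := n) ω| = I} = 2 ^ n * #(peakClass I n) :=
  card_filter_prod_powerset fun V => by simp only [peaks_abs_signedWord, peakClass]

/-- The number of flip-free permutations in `D(S_I, n)`. -/
def flipFreeCount (I : Finset ℕ) (n : ℕ) : ℕ :=
  #{σ : Perm (Fin n) | IsFlipFree n I (code σ)}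

theorem two_pow_mul_card_peakClass {I : Finset ℕ} (hI : I ⊆ Icc 2 (n - 1)) :
    2 ^ #I * #(peakClass I n) = 2 ^ (n - 1) * flipFreeCount I n := by
  have h := (isSignClosed_signedWord n).two_pow_mul_card_peaks_eq hI
  rw [card_peaks_signedWord, (isSignClosed_code n).card_isFlipFree_eq_mul
    (isSignClosed_signedWord n) card_descents_signedWord hI, mul_left_comm,
    mul_left_comm (2 ^ (n - 1))] at h
  exact Nat.eq_of_mul_eq_mul_left (by positivity) h

theorem peakNumber_eq_flipFreeCount {I : Finset ℕ} (hI : I ⊆ Icc 2 (n - 1)) (hn : 0 < n) :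
    peakNumber I n = flipFreeCount I n := by
  have hcard : (2 : ℚ) ^ #I * #(peakClass I n) = 2 ^ (n - 1) * flipFreeCount I n :=
    mod_cast two_pow_mul_card_peakClass hI
  have hexp : -(n : ℤ) + #I + 1 = #I - (n - 1 : ℕ) := by omega
  rw [peakNumber, hexp, zpow_sub₀ two_ne_zero, zpow_natCast, zpow_natCast, div_mul_eq_mul_div,
    hcard, mul_div_cancel_left₀ _ (by positivity)]

end SignedWord

section IncreasingTail

open Equiv (Perm)

variable {m n : ℕ} {σ τ : Perm (Fin n)} {j : ℕ}

/-- The entries of `σ` after position `m` increase. -/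
def HasIncreasingTail (m : ℕ) (σ : Perm (Fin n)) : Prop :=
  ∀ j, m < j → j < n → val σ j < val σ (j + 1)

namespace HasIncreasingTail

theorem isLeast_val (h : HasIncreasingTail m σ) (hmj : m ≤ j) (hjn : j < n) :
    IsLeast (↑(Icc 1 n \ init j σ) : Set ℕ) (val σ (j + 1)) := by
  refine ⟨mem_coe.2 (mem_sdiff.2 ⟨val_mem_Icc σ (by omega), val_notMem_init hjn⟩), fun v hv => ?_⟩
  obtain ⟨hvn, hvj⟩ := mem_sdiff.1 (mem_coe.1 hv)
  obtain ⟨i, hi, rfl⟩ := mem_init.1 (init_self σ ▸ hvn)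
  have hji : j + 1 ≤ i := by
    by_contra! hij
    exact hvj (val_mem_init (by omega))
  have hmono : ∀ k, j + 1 ≤ k → k ≤ n → val σ (j + 1) ≤ val σ k := fun k hk => by
    induction k, hk using Nat.le_induction with
    | base => exact fun _ => le_rfl
    | succ k hk ih => exact fun hkn => (ih (by omega)).trans (h k (by omega) hkn).le
  exact hmono i hji hi.2

theorem eq_of_init_eq_of_code_eq (hσ : HasIncreasingTail m σ) (hτ : HasIncreasingTail m τ)
    (hm : m ≤ n) (hinit : init m σ = init m τ) (hcode : ∀ j ≤ m, code σ j = code τ j) :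
    σ = τ := by
  have hnext : ∀ j, m ≤ j → j < n → init j σ = init j τ → val σ (j + 1) = val τ (j + 1) :=
    fun j hmj hjn h => (hσ.isLeast_val hmj hjn).unique (h ▸ hτ.isLeast_val hmj hjn)
  have hinit' : ∀ j, m ≤ j → j ≤ n → init j σ = init j τ := fun j hj => by
    induction j, hj using Nat.le_induction with
    | base => exact fun _ => hinit
    | succ j hmj ih =>
      exact fun hjn => by rw [init_succ, init_succ, ih (by omega), hnext j hmj hjn (ih (by omega))]
  refine eq_of_forall_val_eq fun j hj => ?_
  rcases le_or_gt j m with hjm | hmj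
  · exact val_eq_of_init_eq_of_code_eq hm hinit hcode j hjm
  · obtain ⟨i, rfl⟩ : ∃ i, j = i + 1 := ⟨j - 1, by omega⟩
    exact hnext i (by omega) hj (hinit' i (by omega) (by omega))

end HasIncreasingTail

/-- The length of the longest interval `{1, …, r}` contained in `A`, for `0 ∉ A`. -/
def initialRun (A : Finset ℕ) : ℕ := #{a ∈ A | Icc 1 a ⊆ A}

theorem initialRun_inter_Icc {A : Finset ℕ} (hzero : 0 ∉ A) (hA : #A ≤ m) :
    initialRun (A ∩ Icc 1 m) = initialRun A := by
  refine congrArg card (ext fun a => ?_)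
  simp only [mem_filter, mem_inter, subset_inter_iff]
  refine ⟨fun h => ⟨h.1.1, h.2.1⟩, fun ⟨haA, hrun⟩ => ?_⟩
  have ham : a ≤ m := by simpa using (card_le_card hrun).trans hA
  have ha : a ≠ 0 := ne_of_mem_of_not_mem haA hzero
  exact ⟨⟨haA, mem_Icc.2 (by omega)⟩, hrun, Icc_subset_Icc_right ham⟩

theorem HasIncreasingTail.code_succ (h : HasIncreasingTail m σ) (hmn : m < n) :
    code σ (m + 1) = 2 * initialRun (init m σ) - m := by
  obtain ⟨hmem, hle⟩ := h.isLeast_val le_rfl hmn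
  obtain ⟨hrange, hnotMem⟩ := mem_sdiff.1 (mem_coe.1 hmem)
  rw [PeakPoly.code_succ σ hmn, initialRun]
  refine congrArg (fun s : Finset ℕ => 2 * (#s : ℤ) - m) (filter_congr fun v hv => ?_)
  have hvn := mem_Icc.1 (init_subset hmn.le hv)
  refine ⟨fun hlt w hw => ?_, fun hrun => ?_⟩
  · have hw := mem_Icc.1 hw
    by_contra hwm
    have := hle (mem_coe.2 (mem_sdiff.2 ⟨mem_Icc.2 (by omega), hwm⟩))
    omega
  · by_contra! hge
    exact hnotMem (hrun (mem_Icc.2 ⟨(mem_Icc.1 hrange).1, hge⟩))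

theorem code_eq_of_val_lt_iff {N : ℕ} {π : Perm (Fin N)} (hmn : m ≤ n) (hmN : m ≤ N)
    (h : ∀ p q : Fin m, val π (p + 1) < val π (q + 1) ↔ val σ (p + 1) < val σ (q + 1)) :
    ∀ j ≤ m, code π j = code σ j := fun j hj => by
  rw [code_of_le _ (hj.trans hmN), code_of_le _ (hj.trans hmn)]
  refine sum_congr rfl fun i hi => if_congr ?_ rfl rfl
  have hi := mem_Ico.1 hi
  have hij := h ⟨i - 1, by omega⟩ ⟨j - 1, by omega⟩
  simpa only [Nat.sub_add_cancel hi.1, Nat.sub_add_cancel (hi.1.trans hi.2.le)] using hij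

theorem exists_code_eq (hmn : m ≤ n) (σ : Perm (Fin n)) :
    ∃ π : Perm (Fin m), ∀ j ≤ m, code π j = code σ j := by
  obtain ⟨π, hπ⟩ := exists_perm_lt_iff_lt (f := fun p : Fin m => val σ (p + 1)) fun p q h =>
    Fin.ext (Nat.add_right_cancel ((val_inj (by omega) (by omega)).1 h))
  refine ⟨π, code_eq_of_val_lt_iff hmn le_rfl fun p q => ?_⟩
  rw [val_fin_succ, val_fin_succ, Nat.add_lt_add_iff_right, Fin.val_fin_lt, hπ]

theorem exists_perm_val_eq {g : Fin n → ℕ} (hg : Function.Injective g) (hgn : ∀ p, g p ∈ Icc 1 n) :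
    ∃ σ : Perm (Fin n), ∀ p : Fin n, val σ (p + 1) = g p := by
  have hpos : ∀ p, g p - 1 + 1 = g p := fun p => Nat.sub_add_cancel (mem_Icc.1 (hgn p)).1
  have hinj : Function.Injective fun p : Fin n =>
      (⟨g p - 1, by have := mem_Icc.1 (hgn p); omega⟩ : Fin n) := fun p q h => by
    rw [Fin.mk.injEq] at h
    exact hg (by rw [← hpos p, h, hpos])
  exact ⟨Equiv.ofBijective _ (Finite.injective_iff_bijective.1 hinj), fun p => by
    rw [val_fin_succ, Equiv.ofBijective_apply, hpos]⟩

theorem exists_hasIncreasingTail (hmn : m ≤ n) {A : Finset ℕ} (hA : A ⊆ Icc 1 n) (hcard : #A = m)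
    (π : Perm (Fin m)) : ∃ σ : Perm (Fin n), HasIncreasingTail m σ ∧ init m σ = A ∧
      ∀ j ≤ m, code π j = code σ j := by
  obtain ⟨N, rfl⟩ := Nat.exists_eq_add_of_le hmn
  have hcompl : #(Icc 1 (m + N) \ A) = N := by
    rw [card_sdiff_of_subset hA, Nat.card_Icc, hcard]
    omega
  let a : Fin m ↪o ℕ := A.orderEmbOfFin hcard
  let b : Fin N ↪o ℕ := (Icc 1 (m + N) \ A).orderEmbOfFin hcompl
  have ha : ∀ p, a p ∈ A := orderEmbOfFin_mem A hcard
  have hb : ∀ q, b q ∈ Icc 1 (m + N) \ A := orderEmbOfFin_mem _ hcompl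
  obtain ⟨σ, hσ⟩ := exists_perm_val_eq (g := Fin.append (a ∘ π) b)
    (Fin.append_injective_iff.2 ⟨a.injective.comp π.injective, b.injective, fun p q h =>
      (mem_sdiff.1 (hb q)).2 (h ▸ ha (π p))⟩)
    (Fin.addCases (fun p => by simpa using hA (ha (π p)))
      fun q => by simpa using (mem_sdiff.1 (hb q)).1)
  have hhead : ∀ p : Fin m, val σ (p + 1) = a (π p) := fun p =>
    (hσ (Fin.castAdd N p)).trans (Fin.append_left ..)
  have htail : ∀ q : Fin N, val σ (m + q + 1) = b q := fun q =>
    (hσ (Fin.natAdd m q)).trans (Fin.append_right ..)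
  refine ⟨σ, fun j hmj hjn => ?_, ?_, code_eq_of_val_lt_iff hmn le_rfl fun p q => ?_⟩
  · have hj := htail ⟨j - m - 1, by omega⟩
    have hj' := htail ⟨j - m, by omega⟩
    rw [show m + (j - m - 1) + 1 = j by omega] at hj
    rw [show m + (j - m) + 1 = j + 1 by omega] at hj'
    rw [hj, hj', b.lt_iff_lt, Fin.mk_lt_mk]
    omega
  · refine eq_of_subset_of_card_le (fun v hv => ?_) (by rw [card_init hmn, hcard])
    obtain ⟨i, hi, rfl⟩ := mem_init.1 hv
    have hi' := hhead ⟨i - 1, by omega⟩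
    rw [Nat.sub_add_cancel hi.1] at hi'
    exact hi' ▸ ha _
  · rw [hhead, hhead, a.lt_iff_lt, val_fin_succ, val_fin_succ, Nat.add_lt_add_iff_right,
      Fin.val_fin_lt]

end IncreasingTail

section FlipFreeCount

variable {m n : ℕ} {I : Finset ℕ}

section Truncation

variable {α : Type*} [AddCommGroup α] [LinearOrder α] {x y : ℕ → α}

theorem isFlipFree_congr (h : ∀ j ≤ n, x j = y j) : IsFlipFree n I x ↔ IsFlipFree n I y := by
  rw [IsFlipFree, IsFlipFree, descents_congr h,
    peaks_congr (x := |x|) (y := |y|) fun j hj => congrArg abs (h j hj)]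

theorem isFlipFree_iff_of_lt [IsOrderedAddMonoid α] (hI : I ⊆ Icc 2 m) (hmn : m < n) :
    IsFlipFree n I x ↔ IsFlipFree (m + 1) I x ∧ ∀ j, m < j → j < n → ¬x (j + 1) < x j := by
  have hIn : I ⊆ Icc 2 (n - 1) := hI.trans (Icc_subset_Icc_right (by omega))
  have hS : spikeDescents I ⊆ Icc 1 m := (spikeDescents_subset_and_setSpike_eq (n := m + 1) hI).1
  simp only [IsFlipFree, descents_succ_of_lt hmn, peaks_succ_of_lt hmn]
  refine ⟨fun ⟨hdes, hpeaks⟩ => ?_, fun ⟨⟨hdes, hpeaks⟩, htail⟩ => ?_⟩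
  · rw [hdes, hpeaks, filter_true_of_mem fun j hj => (mem_Icc.1 (hS hj)).2,
      filter_true_of_mem fun j hj => (mem_Icc.1 (hI hj)).2]
    refine ⟨⟨rfl, rfl⟩, fun j hmj hjn hlt => ?_⟩
    have hj := mem_Icc.1 (hS (hdes ▸ mem_descents.2 ⟨⟨by omega, hjn⟩, hlt⟩))
    omega
  · rw [filter_true_of_mem fun j hj => ?_] at hdes
    · have hle : ∀ j ∈ peaks n |x|, j ≤ m := fun j hj => by
        have hj := peaks_abs_subset_setSpike x hj
        rw [hdes, (spikeDescents_subset_and_setSpike_eq hIn).2] at hj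
        exact (mem_Icc.1 (hI hj)).2
      exact ⟨hdes, by rwa [filter_true_of_mem hle] at hpeaks⟩
    · obtain ⟨⟨-, hjn⟩, hlt⟩ := mem_descents.1 hj
      exact not_lt.1 fun hmj => htail j hmj hjn hlt

end Truncation

open Equiv (Perm)

theorem isFlipFree_code_iff (hI : I ⊆ Icc 2 m) (hmn : m < n) (σ : Perm (Fin n)) :
    IsFlipFree n I (code σ) ↔ IsFlipFree (m + 1) I (code σ) ∧ HasIncreasingTail m σ := by
  rw [isFlipFree_iff_of_lt hI hmn]
  refine and_congr_right' (forall₃_congr fun j hmj hjn => ?_)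
  rw [code_succ_lt_iff (by omega) hjn, not_lt, le_iff_lt_or_eq, val_inj (by omega) (by omega),
    or_iff_left (by omega)]

/-- The number of standardized prefixes `π` of length `m` that can precede an increasing tail
without a flip, when `t` of the first `m` values are smaller than the first value of the tail. -/
def prefixCount (I : Finset ℕ) (m t : ℕ) : ℕ :=
  #{π : Perm (Fin m) | IsFlipFree (m + 1) I (Function.update (code π) (m + 1) (2 * t - m))}

theorem isFlipFree_code_iff_update {σ : Perm (Fin n)} {π : Perm (Fin m)} (hI : I ⊆ Icc 2 m)
    (hmn : m < n) (hσ : HasIncreasingTail m σ) (hπ : ∀ j ≤ m, code π j = code σ j) :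
    IsFlipFree n I (code σ) ↔ IsFlipFree (m + 1) I
      (Function.update (code π) (m + 1) (2 * initialRun (init m σ) - m)) := by
  rw [isFlipFree_code_iff hI hmn, and_iff_left hσ]
  refine isFlipFree_congr fun j hj => ?_
  rcases hj.eq_or_lt with rfl | hj
  · rw [Function.update_self, hσ.code_succ hmn]
  · rw [Function.update_of_ne hj.ne, hπ j (by omega)]

theorem card_isFlipFree_init_eq {A : Finset ℕ} (hI : I ⊆ Icc 2 m) (hmn : m < n)
    (hA : A ⊆ Icc 1 n) (hcard : #A = m) :
    #{σ : Perm (Fin n) | IsFlipFree n I (code σ) ∧ init m σ = A} =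
      prefixCount I m (initialRun A) := by
  choose f hf using exists_hasIncreasingTail hmn.le hA hcard
  have hiff : ∀ π, IsFlipFree n I (code (f π)) ↔
      IsFlipFree (m + 1) I (Function.update (code π) (m + 1) (2 * initialRun A - m)) := fun π => by
    obtain ⟨htail, hinit, hcode⟩ := hf π
    rw [isFlipFree_code_iff_update hI hmn htail hcode, hinit]
  refine (card_bij (fun π _ => f π) (fun π hπ => ?_) (fun π _ ρ _ h => ?_) fun σ hσ => ?_).symm
  · exact mem_filter.2 ⟨mem_univ _, (hiff π).2 (mem_filter.1 hπ).2, (hf π).2.1⟩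
  · refine code_injective (funext fun j => ?_)
    rcases le_or_gt j m with hj | hj
    · rw [(hf π).2.2 j hj, h, (hf ρ).2.2 j hj]
    · rw [code_of_lt _ hj, code_of_lt _ hj]
  · obtain ⟨hfree, hinit⟩ := (mem_filter.1 hσ).2
    obtain ⟨π, hπ⟩ := exists_code_eq hmn.le σ
    have htail := ((isFlipFree_code_iff hI hmn σ).1 hfree).2
    have hfσ : f π = σ := (hf π).1.eq_of_init_eq_of_code_eq htail hmn.le
      ((hf π).2.1.trans hinit.symm) fun j hj => by rw [← (hf π).2.2 j hj, hπ j hj]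
    exact ⟨π, mem_filter.2 ⟨mem_univ _, (hiff π).1 (hfσ ▸ hfree)⟩, hfσ⟩

/-- The sum of `prefixCount` over the possible intersections `B` with `[m]` of a set of `m` values
that has `k` elements greater than `m`. -/
def prefixCoeff (I : Finset ℕ) (m k : ℕ) : ℕ :=
  ∑ B ∈ (Icc 1 m).powerset with #B + k = m, prefixCount I m (initialRun B)

theorem prefixCoeff_eq_zero {k : ℕ} (hk : m < k) : prefixCoeff I m k = 0 := by
  rw [prefixCoeff, filter_false_of_mem fun B _ => by omega, sum_empty]

theorem inter_Icc_eq_and_iff_eq_union {A B C : Finset ℕ} (hmn : m ≤ n) (hA : A ⊆ Icc 1 n)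
    (hB : B ⊆ Icc 1 m) (hC : C ⊆ Icc (m + 1) n) :
    A ∩ Icc (m + 1) n = C ∧ A ∩ Icc 1 m = B ↔ A = B ∪ C := by
  grind

theorem card_inter_Icc_add_card_inter_Icc {A : Finset ℕ} (hmn : m ≤ n) (hA : A ⊆ Icc 1 n) :
    #(A ∩ Icc 1 m) + #(A ∩ Icc (m + 1) n) = #A := by
  rw [← card_union_of_disjoint (by grind [disjoint_left]),
    ← (inter_Icc_eq_and_iff_eq_union hmn hA inter_subset_right inter_subset_right).1 ⟨rfl, rfl⟩]

theorem card_isFlipFree_init_inter_eq {C : Finset ℕ} (hI : I ⊆ Icc 2 m) (hmn : m < n)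
    (hC : C ⊆ Icc (m + 1) n) :
    #{σ : Perm (Fin n) | IsFlipFree n I (code σ) ∧ init m σ ∩ Icc (m + 1) n = C} =
      prefixCoeff I m #C := by
  rw [prefixCoeff, card_eq_sum_card_fiberwise (f := fun σ => init m σ ∩ Icc 1 m)]
  · refine sum_congr rfl fun B hB => ?_
    obtain ⟨hBm, hcard⟩ := mem_filter.1 hB
    have hBm := mem_powerset.1 hBm
    have hA : B ∪ C ⊆ Icc 1 n := union_subset (hBm.trans (Icc_subset_Icc_right hmn.le))
      (hC.trans (Icc_subset_Icc_left (by omega)))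
    have hparts := (inter_Icc_eq_and_iff_eq_union hmn.le hA hBm hC).2 rfl
    have hcardA : #(B ∪ C) = m := by
      rw [← card_inter_Icc_add_card_inter_Icc hmn.le hA, hparts.1, hparts.2, hcard]
    have hrun : initialRun B = initialRun (B ∪ C) := by
      rw [← hparts.2, initialRun_inter_Icc (fun h => by simpa using hA h) hcardA.le, hparts.2]
    rw [hrun, ← card_isFlipFree_init_eq hI hmn hA hcardA, filter_filter]
    refine congrArg card (filter_congr fun σ _ => ?_)
    rw [and_assoc, inter_Icc_eq_and_iff_eq_union hmn.le (init_subset hmn.le) hBm hC]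
  · intro σ hσ
    obtain ⟨-, rfl⟩ := (mem_filter.1 hσ).2
    refine mem_filter.2 ⟨mem_powerset.2 inter_subset_right, ?_⟩
    rw [card_inter_Icc_add_card_inter_Icc hmn.le (init_subset hmn.le), card_init hmn.le]

theorem flipFreeCount_eq_sum (hI : I ⊆ Icc 2 m) (hmn : m < n) :
    flipFreeCount I n = ∑ k ∈ range (m + 1), prefixCoeff I m k * (n - m).choose k := by
  rw [flipFreeCount, card_eq_sum_card_fiberwise (f := fun σ => init m σ ∩ Icc (m + 1) n)
    (t := (Icc (m + 1) n).powerset) fun σ _ => mem_coe.2 (mem_powerset.2 inter_subset_right)]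
  simp only [filter_filter]
  calc ∑ C ∈ (Icc (m + 1) n).powerset,
        #{σ : Perm (Fin n) | IsFlipFree n I (code σ) ∧ init m σ ∩ Icc (m + 1) n = C}
      = ∑ C ∈ (Icc (m + 1) n).powerset, prefixCoeff I m #C := sum_congr rfl fun C hC =>
        card_isFlipFree_init_inter_eq hI hmn (mem_powerset.1 hC)
    _ = ∑ k ∈ range (n - m + 1), prefixCoeff I m k * (n - m).choose k := by
        rw [sum_powerset_apply_card, Nat.card_Icc, Nat.add_sub_add_right]
        simp only [smul_eq_mul, mul_comm]
    _ = ∑ k ∈ range (m + 1), prefixCoeff I m k * (n - m).choose k := by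
        refine sum_congr_of_eq_on_inter (fun k _ hk => ?_) (fun k _ hk => ?_) fun _ _ _ => rfl
        · rw [prefixCoeff_eq_zero (by simpa using hk), zero_mul]
        · rw [Nat.choose_eq_zero_of_lt (by simpa using hk), mul_zero]

theorem peakCoeff_eq_prefixCoeff {k : ℕ} (hI : I ⊆ Icc 2 m) (hk : k ≤ m) :
    peakCoeff I m k = prefixCoeff I m k := by
  classical
  rcases m.eq_zero_or_pos with rfl | hm
  · obtain rfl : I = ∅ := by simpa using hI
    obtain rfl : k = 0 := by omega
    have hdes : spikeDescents ∅ = ∅ := by decide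
    have hleft : peakCoeff ∅ 0 0 = 1 := by
      simp [peakCoeff, descentClass, des, hdes, AdmitsFlip, AdmitsFlipPlus, AdmitsFlipMinus, spike,
        peak, valley]
    rw [hleft]
    decide
  · have hI' : I ⊆ Icc 2 (2 * m - 1) := hI.trans (Icc_subset_Icc_right (by omega))
    have hcard : #(Icc (m + 1) (m + k)) = k := by simp
    rw [← hcard, ← card_isFlipFree_init_inter_eq hI (by omega : m < 2 * m)
      (Icc_subset_Icc_right (by omega)), hcard, peakCoeff]
    refine congrArg card (ext fun σ => ?_)
    simp only [mem_filter, mem_univ, true_and,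
      ← mem_descentClass_and_forall_not_admitsFlip_iff hI', and_assoc,
      and_comm (b := ∀ i, ¬AdmitsFlip σ i)]

end FlipFreeCount

section Expansion

theorem subset_Icc_of_sup_lt {I : Finset ℕ} {n : ℕ} (hI : ∀ i ∈ I, 2 ≤ i) (hn : I.sup id < n) :
    I ⊆ Icc 2 (n - 1) := fun i hi =>
  mem_Icc.2 ⟨hI i hi, Nat.le_sub_one_of_lt ((le_sup (f := id) hi).trans_lt hn)⟩

theorem peakNumber_eq_sum_of_lt {I : Finset ℕ} {m n : ℕ} (hI : ∀ i ∈ I, 2 ≤ i)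
    (hm : I.sup id ≤ m) (hmn : m < n) :
    peakNumber I n =
      ∑ k ∈ range (m + 1), (peakCoeff I m k : ℚ) * Ring.choose ((n : ℚ) - m) k := by
  have hIm : I ⊆ Icc 2 m := subset_Icc_of_sup_lt hI (Nat.lt_succ_of_le hm)
  rw [peakNumber_eq_flipFreeCount (subset_Icc_of_sup_lt hI (hm.trans_lt hmn)) (by omega),
    flipFreeCount_eq_sum hIm hmn, Nat.cast_sum]
  refine sum_congr rfl fun k hk => ?_
  rw [peakCoeff_eq_prefixCoeff hIm (mem_range_succ_iff.1 hk), ← Nat.cast_sub hmn.le,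
    Ring.choose_natCast, Nat.cast_mul]

open Polynomial in
theorem exists_polynomial_eval_eq_sum_choose (m : ℕ) (s : Finset ℕ) (c : ℕ → ℚ) :
    ∃ P : ℚ[X], ∀ x : ℚ, P.eval x = ∑ k ∈ s, c k * Ring.choose (x - m) k := by
  refine ⟨∑ k ∈ s, C (c k) * (C ((k.factorial : ℚ)⁻¹) *
    ((descPochhammer ℤ k).map (algebraMap ℤ ℚ)).comp (X - C (m : ℚ))), fun x => ?_⟩
  rw [eval_finsetSum]
  refine sum_congr rfl fun k _ => ?_
  rw [eval_mul, eval_mul, eval_C, eval_C, eval_comp, eval_sub, eval_X, eval_C,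
    Ring.choose_eq_smul, eval_map_algebraMap, aeval_eq_smeval, smul_eq_mul]

theorem sum_choose_eq_of_eventually_eq {m m' : ℕ} {s s' : Finset ℕ} {c c' : ℕ → ℚ}
    (h : ∀ᶠ n : ℕ in Filter.atTop, ∑ k ∈ s, c k * Ring.choose ((n : ℚ) - m) k =
      ∑ k ∈ s', c' k * Ring.choose ((n : ℚ) - m') k) (x : ℚ) :
    ∑ k ∈ s, c k * Ring.choose (x - m) k = ∑ k ∈ s', c' k * Ring.choose (x - m') k := by
  obtain ⟨L, hL⟩ := Filter.eventually_atTop.1 h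
  obtain ⟨P, hP⟩ := exists_polynomial_eval_eq_sum_choose m s c
  obtain ⟨Q, hQ⟩ := exists_polynomial_eval_eq_sum_choose m' s' c'
  suffices P = Q by rw [← hP, ← hQ, this]
  refine Polynomial.eq_of_infinite_eval_eq P Q <|
    ((Set.Ici_infinite L).image Nat.cast_injective.injOn).mono ?_
  rintro _ ⟨n, hn, rfl⟩
  rw [Set.mem_ofPred, hP, hQ, hL n hn]

theorem coeff_eq_of_forall_sum_choose_eq {R : Type*} [Semiring R] [IsRightCancelAdd R] {m : ℕ}
    {c c' : ℕ → R} (h : ∀ j ≤ m, ∑ k ∈ range (m + 1), c k * (j.choose k : R) =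
      ∑ k ∈ range (m + 1), c' k * (j.choose k : R)) : ∀ j ≤ m, c j = c' j := by
  intro j
  induction j using Nat.strong_induction_on with
  | _ j ih =>
    intro hj
    have htriangular : ∀ a : ℕ → R, ∑ k ∈ range (m + 1), a k * (j.choose k : R) =
        a j + ∑ k ∈ range j, a k * (j.choose k : R) := fun a => by
      rw [← sum_subset (range_subset_range.2 (Nat.succ_le_succ hj)) fun k _ hk => ?_,
        sum_range_succ_comm, Nat.choose_self, Nat.cast_one, mul_one]
      rw [Nat.choose_eq_zero_of_lt (by simpa using hk), Nat.cast_zero, mul_zero]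
    have hlower : ∑ k ∈ range j, c k * (j.choose k : R) = ∑ k ∈ range j, c' k * (j.choose k : R) :=
      sum_congr rfl fun k hk => by
        have hkj := mem_range.1 hk
        rw [ih k hkj (by omega)]
    have hsum := h j hj
    rw [htriangular c, htriangular c', hlower] at hsum
    exact add_right_cancel hsum

theorem coeff_eq_of_eventually_sum_choose_eq {m : ℕ} {c c' : ℕ → ℚ}
    (h : ∀ᶠ n : ℕ in Filter.atTop, ∑ k ∈ range (m + 1), c k * Ring.choose ((n : ℚ) - m) k =
      ∑ k ∈ range (m + 1), c' k * Ring.choose ((n : ℚ) - m) k) : ∀ k ≤ m, c k = c' k := by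
  refine coeff_eq_of_forall_sum_choose_eq fun j _ => ?_
  simpa only [Nat.cast_add, add_sub_cancel_left, Ring.choose_natCast] using
    sum_choose_eq_of_eventually_eq h ((m + j : ℕ) : ℚ)

theorem peakNumber_eq_sum {I : Finset ℕ} {m n : ℕ} (hI : ∀ i ∈ I, 2 ≤ i) (hm : I.sup id ≤ m)
    (hn : I.sup id < n) :
    peakNumber I n =
      ∑ k ∈ range (m + 1), (peakCoeff I m k : ℚ) * Ring.choose ((n : ℚ) - m) k := by
  rw [peakNumber_eq_sum_of_lt hI le_rfl hn]
  refine sum_choose_eq_of_eventually_eq ?_ _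
  filter_upwards [Filter.eventually_gt_atTop m] with N hN
  rw [← peakNumber_eq_sum_of_lt hI le_rfl (hm.trans_lt hN), ← peakNumber_eq_sum_of_lt hI hm hN]

end Expansion

end PeakPoly

theorem mainTheorem1 (I : Finset ℕ) (m : ℕ) (hI : PeakPoly.IsAdmissible I)
    (hm : I.sup id ≤ m) :
    (∀ n : ℕ, I.sup id < n →
      PeakPoly.peakNumber I n =
        ∑ k ∈ Finset.range (m + 1),
          (PeakPoly.peakCoeff I m k : ℚ) * Ring.choose ((n : ℚ) - (m : ℚ)) k) ∧
    (∀ c : ℕ → ℚ,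
      (∀ n : ℕ, I.sup id < n →
        PeakPoly.peakNumber I n =
          ∑ k ∈ Finset.range (m + 1), c k * Ring.choose ((n : ℚ) - (m : ℚ)) k) →
      ∀ k ≤ m, c k = (PeakPoly.peakCoeff I m k : ℚ) ∧ 0 ≤ c k) := by
  have hpos : ∀ i ∈ I, 2 ≤ i := fun i hi => (hI i hi).1
  refine ⟨fun n hn => PeakPoly.peakNumber_eq_sum hpos hm hn, fun c hc k hk => ?_⟩
  have hck : c k = PeakPoly.peakCoeff I m k := by
    refine PeakPoly.coeff_eq_of_eventually_sum_choose_eq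
      (c' := fun k => (PeakPoly.peakCoeff I m k : ℚ)) ?_ k hk
    filter_upwards [Filter.eventually_gt_atTop (I.sup id)] with n hn
    rw [← hc n hn, PeakPoly.peakNumber_eq_sum hpos hm hn]
  exact ⟨hck, hck ▸ Nat.cast_nonneg _⟩
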